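/- **Setting.** Let $d\ge 0$ and $n,K\ge 1$, $T\ge 0$ be integers and let $\mathcal X$ be a set. For $U\subseteq[d]=\{1,\dots,d\}$ let $\mathbf I_U$ be the diagonal $0/1$ matrix selecting the coordinates in $U$. Let $\mathcal S$ be a probability distribution over the subsets of $[d]$, with range $\{U:\mathcal S(U)>0\}$. For $S\sim\mathcal S$ put $p_j=\Pr(j\in S)$. Assume that $\mathcal S$ is nonvacuous, $\Pr(S=\emptyset)=0$, and proper, $p_j>0$ for all $j\in[d]$. Let $\mathbf C(S)$ be the diagonal matrix with entries $1/p_j$ for $j\in S$ and $0$ for $j\notin S$. Let $\ell:\mathbb R^d\times\mathcal X\to\mathbb R$ be such that, for every $\zeta\in\mathcal X$, $\ell(\cdot;\zeta)$ is differentiable and convex, and suppose that for every $U$ in the range of $\mathcal S$ there is given a constant $L_U>0$ with $$|\ell(w+\mathbf I_Uv;\zeta)-\ell(w;\zeta)|\le L_U\|\mathbf I_Uv\|_2\qquad\text{for all } v,w\in\mathbb R^d,\ \zeta\in\mathcal X .$$ For a dataset $D=(\zeta_1,\dots,\zeta_n)\in\mathcal X^n$ let $f(w)=\frac1n\sum_{i=1}^n\ell(w;\zeta_i)$.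 **Algorithm (DP-SkGD).** Input: an initial point $w^0\in\mathbb R^d$, step sizes $\mathbf\Gamma=\mathrm{Diag}(\gamma_1,\dots,\gamma_d)$ with $\gamma_j\in\mathbb R$, the integers $T$ and $K$, the distribution $\mathcal S$, and real noise scales $\sigma_U$. For $t=0,\dots,T-1$: set $\theta^0=w^t$; for $k=0,\dots,K-1$ draw, independently of the past, $S\sim\mathcal S$ and then $\eta\sim\mathcal N(0,\sigma_S^2\mathbf I)$, and set $\theta^{k+1}=\theta^k-\mathbf\Gamma\,\mathbf C(S)\,(\nabla f(\theta^k)+\eta)$; finally set $w^{t+1}=\frac1K\sum_{k=1}^K\theta^k$. Output: $w^T$. **Theorem.** Let $0<\epsilon\le 1$ and $0<\delta<1/3$. If $$\sigma_U^2=\frac{12\,L_U^2\,K\,T\,\log(1/\delta)}{n^2\epsilon^2}\qquad\text{for all } U \text{ in the range of } \mathcal S,$$ then DP-SkGD is $(\epsilon,\delta)$-differentially private: for all datasets $D,D'\in\mathcal X^n$ that differ in at most one entry and every Borel set $B\subseteq\mathbb R^d$, the outputs $\mathcal A(D)$, $\mathcal A(D')$ of the algorithm satisfy $$\Pr(\mathcal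 A(D)\in B)\le e^{\epsilon}\,\Pr(\mathcal A(D')\in B)+\delta .$$ -/

import Mathlib

open MeasureTheory ProbabilityTheory
open scoped ENNReal

noncomputable section

namespace DPSkGD

/-- The model space `ℝ^d` with the Euclidean norm. -/
abbrev Model (d : ℕ) : Type := EuclideanSpace ℝ (Fin d)

/-- `Diag(a₁, …, a_d) v`. -/
def diagMul {d : ℕ} (a : Fin d → ℝ) (v : Model d) : Model d :=
  WithLp.toLp 2 fun j => a j * v j

/-- `I_U v`: the coordinates in `U` are kept, the others are set to `0`. -/
def restrict {d : ℕ} (U : Finset (Fin d)) (v : Model d) : Model d :=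
  diagMul (fun j => if j ∈ U then 1 else 0) v

/-! ### Random subsets of the coordinates -/

/-- `p_j = Prob(j ∈ S)` for `S ∼ 𝒮`. -/
def marginal {d : ℕ} (𝒮 : PMF (Finset (Fin d))) (j : Fin d) : ℝ :=
  (𝒮.toOuterMeasure {U | j ∈ U}).toReal

def Nonvacuous {d : ℕ} (𝒮 : PMF (Finset (Fin d))) : Prop := 𝒮 ∅ = 0

def Proper {d : ℕ} (𝒮 : PMF (Finset (Fin d))) : Prop := ∀ j, 0 < marginal 𝒮 j

/-- The diagonal of the sketch matrix `C(S)`: `1 / p_j` if `j ∈ S` and `0` otherwise. -/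
def sketchDiag {d : ℕ} (𝒮 : PMF (Finset (Fin d))) (S : Finset (Fin d)) (j : Fin d) : ℝ :=
  if j ∈ S then 1 / marginal 𝒮 j else 0

/-! ### Losses -/

/-- Component Lipschitzness: for every `U` in the range (support) of `𝒮`, the constant `L U` is
positive and `|ℓ(w + I_U v; ζ) - ℓ(w; ζ)| ≤ L_U ‖I_U v‖` for all `v`, `w`, `ζ`. -/
def ComponentLipschitz {d : ℕ} {X : Type*} (𝒮 : PMF (Finset (Fin d)))
    (L : Finset (Fin d) → ℝ) (loss : Model d → X → ℝ) : Prop :=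
  ∀ U ∈ 𝒮.support, 0 < L U ∧
    ∀ (ζ : X) (v w : Model d), |loss (w + restrict U v) ζ - loss w ζ| ≤ L U * ‖restrict U v‖

/-- The empirical risk `f(w) = (1/n) ∑ᵢ ℓ(w; ζᵢ)` of the dataset `D = (ζ₁, …, ζ_n)`. -/
def empiricalRisk {d n : ℕ} {X : Type*} (loss : Model d → X → ℝ) (D : Fin n → X)
    (w : Model d) : ℝ :=
  (1 / (n : ℝ)) * ∑ i, loss w (D i)

/-! ### The algorithm -/

/-- The input of the algorithm, apart from the objective function. -/
structure Input (d : ℕ) where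
  /-- the initial point `w⁰` -/
  w₀ : Model d
  /-- the step sizes, `Γ = Diag(γ₁, …, γ_d)` -/
  γ : Fin d → ℝ
  /-- the number of outer iterations -/
  T : ℕ
  /-- the number of inner iterations -/
  K : ℕ
  /-- the sampling distribution over the subsets of the coordinates -/
  𝒮 : PMF (Finset (Fin d))
  /-- the noise scales `σ_U` -/
  σ : Finset (Fin d) → ℝ

/-- The inner update `θ - Γ C(S) (∇f(θ) + η)`, for a given sampled set `S` and noise vector `η`. -/
def update {d : ℕ} (I : Input d) (f : Model d → ℝ) (S : Finset (Fin d)) (θ η : Model d) :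
    Model d :=
  θ - diagMul I.γ (diagMul (sketchDiag I.𝒮 S) (gradient f θ + η))

/-- The law of `η ∼ N(0, σ_S² I)`. -/
def noiseLaw {d : ℕ} (I : Input d) (S : Finset (Fin d)) : Measure (Model d) :=
  multivariateGaussian 0 (I.σ S ^ 2 • (1 : Matrix (Fin d) (Fin d) ℝ))

/-- The law of `θ^{k+1}` given `θ^k = θ`: draw `S ∼ 𝒮`, then `η ∼ N(0, σ_S² I)`, and update. -/
def stepLaw {d : ℕ} (I : Input d) (f : Model d → ℝ) (θ : Model d) : Measure (Model d) :=
  ∑ S : Finset (Fin d), I.𝒮 S • (noiseLaw I S).map (update I f S θ)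

/-- The joint law of `(θ^k, θ^1 + ⋯ + θ^k)` after `k` inner iterations started at `θ^0 = w`. -/
def innerLaw {d : ℕ} (I : Input d) (f : Model d → ℝ) (w : Model d) :
    ℕ → Measure (Model d × Model d)
  | 0 => Measure.dirac (w, 0)
  | k + 1 => (innerLaw I f w k).bind fun s =>
      (stepLaw I f s.1).map fun θ' => (θ', s.2 + θ')

/-- The law of `w^t`, where `w^{t+1} = (1/K) ∑_{k=1}^K θ^k` for the `K` inner iterates of the
`t`-th outer iteration, which are started at `θ^0 = w^t` and use fresh randomness. -/
def outerLaw {d : ℕ} (I : Input d) (f : Model d → ℝ) : ℕ → Measure (Model d)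
  | 0 => Measure.dirac I.w₀
  | t + 1 => (outerLaw I f t).bind fun w =>
      (innerLaw I f w I.K).map fun s => (1 / (I.K : ℝ)) • s.2

/-! The laws above are measurable in the starting point, and are probability measures. -/

lemma measurable_diagMul {d : ℕ} (a : Fin d → ℝ) : Measurable (diagMul a) := by
  unfold diagMul
  fun_prop

lemma measurable_gradient {d : ℕ} (f : Model d → ℝ) : Measurable (gradient f) :=
  (InnerProductSpace.toDual ℝ (Model d)).symm.continuous.measurable.comp (measurable_fderiv ℝ f)

lemma measurable_update {d : ℕ} (I : Input d) (f : Model d → ℝ) (S : Finset (Fin d)) :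
    Measurable fun x : Model d × Model d => update I f S x.1 x.2 :=
  measurable_fst.sub ((measurable_diagMul _).comp ((measurable_diagMul _).comp
    (((measurable_gradient f).comp measurable_fst).add measurable_snd)))

lemma measurable_map_of_uncurry {α β γ : Type*} [MeasurableSpace α] [MeasurableSpace β]
    [MeasurableSpace γ] {ν : α → Measure β} [∀ a, IsProbabilityMeasure (ν a)] (hν : Measurable ν)
    {g : α → β → γ} (hg : Measurable (Function.uncurry g)) :
    Measurable fun a => (ν a).map (g a) := by
  let κ : Kernel α β := ⟨ν, hν⟩
  have : IsMarkovKernel κ := ⟨fun a => inferInstanceAs (IsProbabilityMeasure (ν a))⟩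
  refine Measure.measurable_of_measurable_coe _ fun s hs => ?_
  have h : ∀ a, ((ν a).map (g a)) s = κ a (Prod.mk a ⁻¹' (Function.uncurry g ⁻¹' s)) := fun a =>
    Measure.map_apply (hg.comp measurable_prodMk_left) hs
  simp_rw [h]
  exact Kernel.measurable_kernel_prodMk_left (κ := κ) (hg hs)

instance {d : ℕ} (I : Input d) (S : Finset (Fin d)) : IsProbabilityMeasure (noiseLaw I S) := by
  unfold noiseLaw
  infer_instance

instance isProbabilityMeasure_stepLaw {d : ℕ} (I : Input d) (f : Model d → ℝ) (θ : Model d) :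
    IsProbabilityMeasure (stepLaw I f θ) := by
  constructor
  have h : ∀ S, ((noiseLaw I S).map (update I f S θ)) Set.univ = 1 := fun S => by
    have hm : Measurable (update I f S θ) :=
      (measurable_update I f S).comp (measurable_prodMk_left (x := θ))
    rw [Measure.map_apply hm MeasurableSet.univ, Set.preimage_univ, measure_univ]
  simp only [stepLaw, Measure.coe_finsetSum, Finset.sum_apply, Measure.smul_apply, h, smul_eq_mul,
    mul_one]
  rw [← tsum_fintype (L := SummationFilter.unconditional _), I.𝒮.tsum_coe]

lemma measurable_stepLaw {d : ℕ} (I : Input d) (f : Model d → ℝ) : Measurable (stepLaw I f) := by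
  refine Measure.measurable_of_measurable_coe _ fun s hs => ?_
  simp only [stepLaw, Measure.coe_finsetSum, Finset.sum_apply, Measure.smul_apply, smul_eq_mul]
  refine Finset.measurable_sum _ fun S _ => Measurable.const_mul ?_ _
  exact (Measure.measurable_coe hs).comp
    (measurable_map_of_uncurry (ν := fun _ : Model d => noiseLaw I S) measurable_const
      (g := update I f S) (measurable_update I f S))

lemma measurable_innerStep {d : ℕ} (I : Input d) (f : Model d → ℝ) :
    Measurable fun s : Model d × Model d =>
      (stepLaw I f s.1).map fun θ' => ((θ', s.2 + θ') : Model d × Model d) :=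
  measurable_map_of_uncurry (ν := fun s : Model d × Model d => stepLaw I f s.1)
    ((measurable_stepLaw I f).comp measurable_fst)
    (g := fun s θ' => (θ', s.2 + θ')) (by unfold Function.uncurry; fun_prop)

instance isProbabilityMeasure_innerLaw {d : ℕ} (I : Input d) (f : Model d → ℝ) (w : Model d)
    (k : ℕ) : IsProbabilityMeasure (innerLaw I f w k) := by
  induction k with
  | zero => unfold innerLaw; infer_instance
  | succ k ih =>
    unfold innerLaw
    exact isProbabilityMeasure_bind (measurable_innerStep I f).aemeasurable
      (Filter.Eventually.of_forall fun s => Measure.isProbabilityMeasure_map (by fun_prop))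

lemma measurable_innerLaw {d : ℕ} (I : Input d) (f : Model d → ℝ) (k : ℕ) :
    Measurable fun w => innerLaw I f w k := by
  induction k with
  | zero => unfold innerLaw; exact Measure.measurable_dirac.comp (by fun_prop)
  | succ k ih =>
    unfold innerLaw
    exact (Measure.measurable_bind' (measurable_innerStep I f)).comp ih

lemma measurable_outerStep {d : ℕ} (I : Input d) (f : Model d → ℝ) :
    Measurable fun w : Model d =>
      (innerLaw I f w I.K).map fun s => (1 / (I.K : ℝ)) • s.2 :=
  (Measure.measurable_map _ (by fun_prop)).comp (measurable_innerLaw I f I.K)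

instance isProbabilityMeasure_outerLaw {d : ℕ} (I : Input d) (f : Model d → ℝ) (t : ℕ) :
    IsProbabilityMeasure (outerLaw I f t) := by
  induction t with
  | zero => unfold outerLaw; infer_instance
  | succ t ih =>
    unfold outerLaw
    exact isProbabilityMeasure_bind (measurable_outerStep I f).aemeasurable
      (Filter.Eventually.of_forall fun s => Measure.isProbabilityMeasure_map (by fun_prop))

/-- DP-SkGD as a randomized algorithm: it maps a dataset `D` to the law of the output `w^T`. -/
def dpSkGD {d n : ℕ} {X : Type*} (I : Input d) (loss : Model d → X → ℝ) (D : Fin n → X) :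
    ProbabilityMeasure (Model d) :=
  ⟨outerLaw I (empiricalRisk loss D) I.T, inferInstance⟩

/-! ### Differential privacy -/

/-- Two datasets of the same size are neighboring if they differ on at most one element. -/
def Neighboring {n : ℕ} {X : Type*} (D D' : Fin n → X) : Prop :=
  {i | D i ≠ D' i}.ncard ≤ 1

/-- `(ε, δ)`-differential privacy of a randomized algorithm `A`. -/
def IsDifferentiallyPrivate {n : ℕ} {X V : Type*} [MeasurableSpace V]
    (A : (Fin n → X) → ProbabilityMeasure V) (ε δ : ℝ) : Prop :=
  ∀ D D' : Fin n → X, Neighboring D D' → ∀ U : Set V, MeasurableSet U →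
    (A D : Measure V) U
      ≤ ENNReal.ofReal (Real.exp ε) * (A D' : Measure V) U + ENNReal.ofReal δ

end DPSkGD

end

/-! The argument is Rényi-type accounting at a single order α, phrased dually so that densities
never have to be composed. `HolderDominated` records the L^α size of dP/dQ through its action on
test functions; in this form it passes through images and mixtures, and its constants multiply under
composition of kernels (`HolderDominated.bind`). In one inner step, changing the objective amounts
to translating the noise by the difference of the gradients restricted to S
(`update_eq_update_add`). By component Lipschitzness that translation has norm at most 2 L_S / n, so
`holderDominated_add_multivariateGaussian` gives a constant independent of θ and S, because σ_S is
proportional to L_S. Composing the K T steps and applying weighted AM-GM (`apply_le_exp_mul_add`)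
gives (ε, δ) for a suitable α. Convexity plays no role. -/

namespace DPSkGD

/-! ### A dual form of Rényi divergence bounds -/

/-- `∫ g dP ≤ c (∫ g ^ β dQ) ^ (1 / β)` for all measurable `g ≥ 0`. For `β` conjugate to `α`, this is
dual to the bound `c` on the `L^α(Q)`-norm of the density of `P` with respect to `Q`, that is, to a
bound on the Rényi divergence of order `α`. -/
def HolderDominated {Ω : Type*} [MeasurableSpace Ω] (β : ℝ) (c : ℝ≥0∞) (P Q : Measure Ω) : Prop :=
  ∀ g : Ω → ℝ≥0∞, Measurable g → ∫⁻ x, g x ∂P ≤ c * (∫⁻ x, g x ^ β ∂Q) ^ (1 / β)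

namespace HolderDominated

variable {Ω Ω' : Type*} [MeasurableSpace Ω] [MeasurableSpace Ω'] {β : ℝ} {c c' : ℝ≥0∞}

lemma mono {P Q : Measure Ω} (h : HolderDominated β c P Q) (hc : c ≤ c') :
    HolderDominated β c' P Q :=
  fun g hg => (h g hg).trans (by gcongr)

lemma dirac (hβ : 0 < β) (x : Ω) : HolderDominated β 1 (Measure.dirac x) (Measure.dirac x) := by
  intro g hg
  rw [lintegral_dirac' _ hg, lintegral_dirac' _ (hg.pow_const β), one_mul, ← ENNReal.rpow_mul,
    mul_one_div_cancel hβ.ne', ENNReal.rpow_one]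

lemma map {P Q : Measure Ω} (h : HolderDominated β c P Q) {f : Ω → Ω'} (hf : Measurable f) :
    HolderDominated β c (P.map f) (Q.map f) := by
  intro g hg
  rw [lintegral_map hg hf, lintegral_map (hg.pow_const β) hf]
  exact h _ (hg.comp hf)

/-- Adaptive composition: the inner bound produces a function of x to a power 1/β, which is itself a
legitimate test function for the outer bound, where the power β cancels it. -/
lemma bind (hβ : 0 < β) {P Q : Measure Ω} (h : HolderDominated β c P Q) {κ κ' : Ω → Measure Ω'}
    (hκ : Measurable κ) (hκ' : Measurable κ') (hd : ∀ x, HolderDominated β c' (κ x) (κ' x)) :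
    HolderDominated β (c' * c) (P.bind κ) (Q.bind κ') := by
  intro g hg
  have hm : Measurable fun x => ∫⁻ y, g y ^ β ∂κ' x :=
    (Measure.measurable_lintegral (hg.pow_const β)).comp hκ'
  rw [Measure.lintegral_bind hκ.aemeasurable hg.aemeasurable,
    Measure.lintegral_bind hκ'.aemeasurable (hg.pow_const β).aemeasurable]
  calc ∫⁻ x, ∫⁻ y, g y ∂κ x ∂P
      ≤ ∫⁻ x, c' * (∫⁻ y, g y ^ β ∂κ' x) ^ (1 / β) ∂P := lintegral_mono fun x => hd x g hg
    _ = c' * ∫⁻ x, (∫⁻ y, g y ^ β ∂κ' x) ^ (1 / β) ∂P :=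
      lintegral_const_mul _ (hm.pow_const _)
    _ ≤ c' * (c * (∫⁻ x, ((∫⁻ y, g y ^ β ∂κ' x) ^ (1 / β)) ^ β ∂Q) ^ (1 / β)) := by
      gcongr
      exact h _ (hm.pow_const _)
    _ = c' * c * (∫⁻ x, ∫⁻ y, g y ^ β ∂κ' x ∂Q) ^ (1 / β) := by
      simp_rw [← ENNReal.rpow_mul, one_div_mul_cancel hβ.ne', ENNReal.rpow_one, mul_assoc]

/-- Mixtures with common weights. -/
lemma sum_smul (hβ : 1 ≤ β) {ι : Type*} [Fintype ι] {w : ι → ℝ≥0∞} (hw : ∑ i, w i = 1)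
    {P Q : ι → Measure Ω} (h : ∀ i, w i ≠ 0 → HolderDominated β c (P i) (Q i)) :
    HolderDominated β c (∑ i, w i • P i) (∑ i, w i • Q i) := by
  intro g hg
  have hβ0 : 0 < β := by linarith
  simp only [lintegral_finsetSum_measure, lintegral_smul_measure, smul_eq_mul]
  calc ∑ i, w i * ∫⁻ x, g x ∂P i
      ≤ ∑ i, w i * (c * (∫⁻ x, g x ^ β ∂Q i) ^ (1 / β)) := by
        refine Finset.sum_le_sum fun i _ => ?_
        by_cases hi : w i = 0
        · simp [hi]
        · gcongr
          exact h i hi g hg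
    _ = c * ∑ i, w i * (∫⁻ x, g x ^ β ∂Q i) ^ (1 / β) := by
        rw [Finset.mul_sum]
        exact Finset.sum_congr rfl fun i _ => by ring
    _ ≤ c * (∑ i, w i * ∫⁻ x, g x ^ β ∂Q i) ^ (1 / β) := by
        gcongr
        -- Jensen's inequality for the convex function x ↦ x ^ β and the weights w.
        rw [one_div, ENNReal.le_rpow_inv_iff hβ0, ← one_div]
        refine (ENNReal.rpow_arith_mean_le_arith_mean_rpow _ _ _ hw hβ).trans_eq ?_
        simp_rw [← ENNReal.rpow_mul, one_div_mul_cancel hβ0.ne', ENNReal.rpow_one]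

lemma apply_le (hβ : 0 < β) {P Q : Measure Ω} (h : HolderDominated β c P Q) {A : Set Ω}
    (hA : MeasurableSet A) : P A ≤ c * Q A ^ (1 / β) := by
  have h1 := h (A.indicator 1) (measurable_one.indicator hA)
  have h2 : (fun x => A.indicator (1 : Ω → ℝ≥0∞) x ^ β) = A.indicator 1 := by
    ext x
    by_cases hx : x ∈ A <;> simp [hx, hβ]
  rwa [h2, lintegral_indicator_one hA, lintegral_indicator_one hA] at h1

/-- Conversion to an `(ε, δ)`-bound. -/
lemma apply_le_exp_mul_add {α r ε δ : ℝ} (hα : α.HolderConjugate β) {P Q : Measure Ω}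
    [IsFiniteMeasure Q]
    (h : HolderDominated β (ENNReal.ofReal (Real.exp r)) P Q) (hδ : 0 ≤ δ)
    (hr : Real.exp (α * r - (α - 1) * ε) ≤ δ) {A : Set Ω} (hA : MeasurableSet A) :
    P A ≤ ENNReal.ofReal (Real.exp ε) * Q A + ENNReal.ofReal δ := by
  refine (h.apply_le hα.symm.pos hA).trans ?_
  have hq : Q A = ENNReal.ofReal (Q A).toReal := (ENNReal.ofReal_toReal (measure_ne_top _ _)).symm
  have hq0 : 0 ≤ (Q A).toReal := ENNReal.toReal_nonneg
  generalize (Q A).toReal = q at hq hq0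
  have hα0 := hα.pos
  have hβ0 := hα.symm.pos
  have hconj : 1 / β = 1 - α⁻¹ := by
    rw [one_div, ← hα.inv_add_inv_eq_one]; ring
  rw [hq, ENNReal.ofReal_rpow_of_nonneg hq0 (by positivity),
    ← ENNReal.ofReal_mul (Real.exp_nonneg _), ← ENNReal.ofReal_mul (Real.exp_nonneg _),
    ← ENNReal.ofReal_add (by positivity) hδ]
  refine ENNReal.ofReal_le_ofReal ?_
  -- Split exp r * q ^ (1 / β) as a geometric mean of exp ε * q and a remainder; the remainder is
  -- then forced to be the quantity bounded by δ in `hr`.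
  have key := Real.geom_mean_le_arith_mean2_weighted (w₁ := 1 / β) (w₂ := α⁻¹)
    (p₁ := Real.exp ε * q) (p₂ := Real.exp (α * r - (α - 1) * ε))
    (by positivity) (by positivity) (by positivity) (Real.exp_nonneg _) (by rw [hconj]; ring)
  have hexp : Real.exp r = Real.exp ε ^ (1 / β) * Real.exp (α * r - (α - 1) * ε) ^ α⁻¹ := by
    rw [← Real.exp_mul, ← Real.exp_mul, ← Real.exp_add, hconj]
    congr 1
    field_simp
    ring
  have hw1 : 1 / β ≤ 1 := by rw [hconj]; linarith [inv_pos.mpr hα0]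
  have hw2 : α⁻¹ ≤ 1 := inv_le_one_of_one_le₀ hα.lt.le
  calc Real.exp r * q ^ (1 / β)
      = (Real.exp ε * q) ^ (1 / β) * Real.exp (α * r - (α - 1) * ε) ^ α⁻¹ := by
        rw [hexp, Real.mul_rpow (Real.exp_nonneg _) hq0]; ring
    _ ≤ _ := key
    _ ≤ 1 * (Real.exp ε * q) + 1 * δ := by gcongr
    _ = _ := by ring

end HolderDominated

/-! ### Shifts of Gaussian measures -/

lemma gaussianReal_eq_withDensity (u : ℝ) :
    gaussianReal u 1 =
      (gaussianReal 0 1).withDensity fun x => ENNReal.ofReal (Real.exp (u * x - u ^ 2 / 2)) := by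
  rw [gaussianReal_of_var_ne_zero u one_ne_zero, gaussianReal_of_var_ne_zero 0 one_ne_zero,
    ← withDensity_mul _ (measurable_gaussianPDF 0 1) (by fun_prop)]
  congr 1
  ext x
  rw [Pi.mul_apply, gaussianPDF, gaussianPDF, ← ENNReal.ofReal_mul (gaussianPDFReal_nonneg _ _ _),
    gaussianPDFReal, gaussianPDFReal, mul_assoc _ (Real.exp _) (Real.exp _), ← Real.exp_add]
  congr 3
  simp
  ring

lemma map_add_pi_gaussianReal {ι : Type*} [Fintype ι] (u : ι → ℝ) :
    (Measure.pi fun _ : ι => gaussianReal 0 1).map (· + u) =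
      (Measure.pi fun _ : ι => gaussianReal 0 1).withDensity
        fun x => ∏ i, ENNReal.ofReal (Real.exp (u i * x i - u i ^ 2 / 2)) := by
  have h1 : (Measure.pi fun _ : ι => gaussianReal 0 1).map (· + u) =
      Measure.pi fun i => gaussianReal (u i) 1 := by
    have h := Measure.pi_map_pi (μ := fun _ : ι => gaussianReal 0 1) (f := fun i x => x + u i)
      (fun i => by fun_prop)
    simp only [gaussianReal_map_add_const, zero_add] at h
    exact h
  rw [h1]
  refine Measure.pi_eq fun s hs => ?_
  rw [withDensity_apply _ (MeasurableSet.univ_pi hs), ← lintegral_indicator (MeasurableSet.univ_pi hs)]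
  have h2 : ∀ x : ι → ℝ, (Set.univ.pi s).indicator
      (fun x => ∏ i, ENNReal.ofReal (Real.exp (u i * x i - u i ^ 2 / 2))) x =
      ∏ i, (s i).indicator (fun y => ENNReal.ofReal (Real.exp (u i * y - u i ^ 2 / 2))) (x i) := by
    intro x
    by_cases hx : x ∈ Set.univ.pi s
    · rw [Set.indicator_of_mem hx]
      exact Finset.prod_congr rfl fun i _ => by
        rw [Set.indicator_of_mem (hx i trivial)]
    · rw [Set.indicator_of_notMem hx]
      simp only [Set.mem_univ_pi, not_forall] at hx
      obtain ⟨i, hi⟩ := hx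
      exact (Finset.prod_eq_zero (Finset.mem_univ i) (Set.indicator_of_notMem hi _)).symm
  have hm : ∀ i, Measurable ((s i).indicator
      fun y : ℝ => ENNReal.ofReal (Real.exp (u i * y - u i ^ 2 / 2))) := fun i =>
    Measurable.indicator (by fun_prop) (hs i)
  simp_rw [h2]
  rw [lintegral_prod_eq_prod_lintegral_of_indepFun Finset.univ
    (fun i (x : ι → ℝ) => (s i).indicator
      (fun y => ENNReal.ofReal (Real.exp (u i * y - u i ^ 2 / 2))) (x i))
    (iIndepFun_pi fun i => (hm i).aemeasurable) fun i => (hm i).comp (measurable_pi_apply i)]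
  refine Finset.prod_congr rfl fun i _ => ?_
  rw [gaussianReal_eq_withDensity (u i), withDensity_apply _ (hs i), ← lintegral_indicator (hs i)]
  exact ((measurePreserving_eval (fun _ : ι => gaussianReal 0 1) i).lintegral_comp (hm i))

/-- The Cameron–Martin formula for the standard Gaussian measure on `ℝ^d`. -/
lemma lintegral_add_stdGaussian {d : ℕ} (u : Model d) {g : Model d → ℝ≥0∞} (hg : Measurable g) :
    ∫⁻ x, g (x + u) ∂stdGaussian (Model d) =
      ∫⁻ x, ENNReal.ofReal (Real.exp (inner ℝ u x - ‖u‖ ^ 2 / 2)) * g x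
        ∂stdGaussian (Model d) := by
  have hL : Measurable (WithLp.toLp 2 : (Fin d → ℝ) → Model d) := by fun_prop
  rw [← map_pi_eq_stdGaussian, lintegral_map (by fun_prop) hL, lintegral_map (by fun_prop) hL]
  have h1 : ∀ x : Fin d → ℝ, WithLp.toLp 2 x + u = WithLp.toLp 2 (x + WithLp.ofLp u) := fun x => rfl
  simp_rw [h1]
  rw [← lintegral_map (f := fun x : Fin d → ℝ => g (WithLp.toLp 2 x)) (hg.comp hL) (by fun_prop),
    map_add_pi_gaussianReal, lintegral_withDensity_eq_lintegral_mul _ (by fun_prop)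
      (g := fun x => g (WithLp.toLp 2 x)) (hg.comp hL)]
  refine lintegral_congr fun x => ?_
  rw [Pi.mul_apply, ← ENNReal.ofReal_prod_of_nonneg fun _ _ => Real.exp_nonneg _, ← Real.exp_sum,
    EuclideanSpace.real_norm_sq_eq, Finset.sum_sub_distrib, ← Finset.sum_div, PiLp.inner_apply]
  simp [mul_comm]

/-- The Cameron–Martin density has total mass 1: take g = 1. -/
lemma lintegral_exp_inner_stdGaussian {d : ℕ} (a : Model d) :
    ∫⁻ x, ENNReal.ofReal (Real.exp (inner ℝ a x)) ∂stdGaussian (Model d) =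
      ENNReal.ofReal (Real.exp (‖a‖ ^ 2 / 2)) := by
  have h := lintegral_add_stdGaussian a (g := 1) measurable_one
  simp only [Pi.one_apply, lintegral_one, measure_univ, mul_one, sub_eq_add_neg, Real.exp_add,
    ENNReal.ofReal_mul (Real.exp_nonneg _)] at h
  rw [lintegral_mul_const _ (by fun_prop)] at h
  rw [← mul_one (ENNReal.ofReal (Real.exp (‖a‖ ^ 2 / 2))), h, mul_comm, mul_assoc,
    ← ENNReal.ofReal_mul (Real.exp_nonneg _), ← Real.exp_add, neg_add_cancel, Real.exp_zero,
    ENNReal.ofReal_one, mul_one]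

/-- Hölder's inequality separates g from the Cameron–Martin density, whose α-th moment is exp((α² -
α) ‖u‖² / 2); the α-th root leaves the factor α - 1. -/
lemma holderDominated_add_stdGaussian {α β : ℝ} (hα : α.HolderConjugate β) {d : ℕ} (u : Model d) :
    HolderDominated β (ENNReal.ofReal (Real.exp ((α - 1) * (‖u‖ ^ 2 / 2))))
      ((stdGaussian (Model d)).map (· + u)) (stdGaussian (Model d)) := by
  intro g hg
  rw [lintegral_map hg (by fun_prop), lintegral_add_stdGaussian u hg]
  refine (ENNReal.lintegral_mul_le_Lp_mul_Lq _ hα (by fun_prop) hg.aemeasurable).trans_eq ?_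
  congr 1
  have h : ∀ x : Model d, ENNReal.ofReal (Real.exp (inner ℝ u x - ‖u‖ ^ 2 / 2)) ^ α =
      ENNReal.ofReal (Real.exp (inner ℝ (α • u) x)) *
        ENNReal.ofReal (Real.exp (-(α * (‖u‖ ^ 2 / 2)))) := by
    intro x
    rw [ENNReal.ofReal_rpow_of_pos (Real.exp_pos _), ← Real.exp_mul,
      ← ENNReal.ofReal_mul (Real.exp_nonneg _), ← Real.exp_add, real_inner_smul_left]
    ring_nf
  simp_rw [h]
  rw [lintegral_mul_const _ (by fun_prop), lintegral_exp_inner_stdGaussian,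
    ← ENNReal.ofReal_mul (Real.exp_nonneg _), ← Real.exp_add,
    ENNReal.ofReal_rpow_of_pos (Real.exp_pos _), ← Real.exp_mul, norm_smul, mul_pow,
    Real.norm_eq_abs, sq_abs]
  congr 2
  have := hα.pos.ne'
  field_simp
  ring

lemma multivariateGaussian_sq_smul_one {d : ℕ} (σ : ℝ) :
    multivariateGaussian 0 (σ ^ 2 • (1 : Matrix (Fin d) (Fin d) ℝ)) =
      (stdGaussian (Model d)).map (σ • ·) := by
  refine Measure.ext_of_charFun ?_
  ext t
  rw [charFun_multivariateGaussian (Matrix.PosSemidef.one.smul (sq_nonneg σ)), charFun_map_smul,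
    charFun_stdGaussian, ← Complex.ofReal_pow, norm_smul, mul_pow, Real.norm_eq_abs, sq_abs,
    EuclideanSpace.real_norm_sq_eq]
  simp [dotProduct, Matrix.smul_mulVec, Finset.mul_sum, sq, neg_div, mul_left_comm]

lemma holderDominated_add_multivariateGaussian {α β : ℝ} (hα : α.HolderConjugate β) {d : ℕ}
    {σ : ℝ} (hσ : σ ≠ 0) (u : Model d) :
    HolderDominated β (ENNReal.ofReal (Real.exp ((α - 1) * (‖u‖ ^ 2 / (2 * σ ^ 2)))))
      ((multivariateGaussian 0 (σ ^ 2 • (1 : Matrix (Fin d) (Fin d) ℝ))).map (· + u))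
      (multivariateGaussian 0 (σ ^ 2 • (1 : Matrix (Fin d) (Fin d) ℝ))) := by
  have h := (holderDominated_add_stdGaussian hα (σ⁻¹ • u)).map
    (f := fun x : Model d => σ • x) (by fun_prop)
  rw [multivariateGaussian_sq_smul_one, Measure.map_map (by fun_prop) (by fun_prop)]
  rw [Measure.map_map (by fun_prop) (by fun_prop)] at h
  have hn : ‖σ⁻¹ • u‖ ^ 2 / 2 = ‖u‖ ^ 2 / (2 * σ ^ 2) := by
    rw [norm_smul, mul_pow, Real.norm_eq_abs, sq_abs]
    field_simp
  have hf : (fun x : Model d => σ • x) ∘ (· + σ⁻¹ • u) = (· + u) ∘ (σ • ·) := by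
    ext1 x
    simp [smul_smul, hσ]
  rwa [hn, hf] at h

/-! ### Sensitivity of the gradient -/

lemma restrict_apply {d : ℕ} (U : Finset (Fin d)) (v : Model d) (j : Fin d) :
    restrict U v j = if j ∈ U then v j else 0 := by
  simp [restrict, diagMul]

lemma restrict_smul {d : ℕ} (U : Finset (Fin d)) (a : ℝ) (v : Model d) :
    restrict U (a • v) = a • restrict U v := by
  ext j
  simp [restrict_apply]

lemma restrict_sub {d : ℕ} (U : Finset (Fin d)) (v w : Model d) :
    restrict U (v - w) = restrict U v - restrict U w := by
  ext j
  simp only [restrict_apply, PiLp.sub_apply]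
  split <;> simp

lemma inner_restrict_self {d : ℕ} (U : Finset (Fin d)) (v : Model d) :
    inner ℝ v (restrict U v) = ‖restrict U v‖ ^ 2 := by
  rw [EuclideanSpace.real_norm_sq_eq, PiLp.inner_apply]
  refine Finset.sum_congr rfl fun j _ => ?_
  rw [restrict_apply]
  split <;> simp [sq]

/-- The derivative in the direction r of the restricted gradient is ‖r‖², while the Lipschitz bound
along r allows at most L ‖r‖. -/
lemma norm_restrict_gradient_le {d : ℕ} {U : Finset (Fin d)} {L : ℝ} (hL : 0 ≤ L)
    {g : Model d → ℝ} {θ : Model d} (hg : DifferentiableAt ℝ g θ)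
    (hlip : ∀ v, |g (θ + restrict U v) - g θ| ≤ L * ‖restrict U v‖) :
    ‖restrict U (gradient g θ)‖ ≤ L := by
  set r := restrict U (gradient g θ) with hr
  have h1 : HasLineDerivAt ℝ g (‖r‖ ^ 2) θ r := by
    have h := hg.hasGradientAt.hasFDerivAt.hasLineDerivAt r
    rwa [InnerProductSpace.toDual_apply_apply, hr, inner_restrict_self] at h
  have h2 : ‖‖r‖ ^ 2‖ ≤ L * ‖r‖ := by
    have h3 : HasDerivAt (fun t : ℝ => g (θ + t • r)) (‖r‖ ^ 2) 0 := h1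
    refine h3.le_of_lip' (by positivity) (Filter.Eventually.of_forall fun t => ?_)
    have h4 := hlip (t • gradient g θ)
    rw [restrict_smul, ← hr, norm_smul] at h4
    simp only [zero_smul, add_zero, sub_zero]
    exact h4.trans_eq (by ring)
  rw [norm_pow, norm_norm, sq] at h2
  by_contra! hlt
  nlinarith

lemma gradient_empiricalRisk {d n : ℕ} {X : Type*} {loss : Model d → X → ℝ}
    (h_diff : ∀ ζ, Differentiable ℝ fun w => loss w ζ) (D : Fin n → X) (θ : Model d) :
    gradient (empiricalRisk loss D) θ =
      (1 / (n : ℝ)) • ∑ i, gradient (fun w => loss w (D i)) θ := by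
  refine HasGradientAt.gradient ?_
  rw [hasGradientAt_iff_hasFDerivAt]
  have h := (HasFDerivAt.fun_sum (u := Finset.univ) fun i _ =>
    ((h_diff (D i)).differentiableAt (x := θ)).hasGradientAt.hasFDerivAt).const_mul (1 / (n : ℝ))
  simp only [map_smul, map_sum]
  exact h

lemma norm_restrict_gradient_empiricalRisk_sub_le {d n : ℕ} {X : Type*} {U : Finset (Fin d)}
    {L : ℝ} (hL : 0 ≤ L) {loss : Model d → X → ℝ}
    (h_diff : ∀ ζ, Differentiable ℝ fun w => loss w ζ)
    (hlip : ∀ ζ v w, |loss (w + restrict U v) ζ - loss w ζ| ≤ L * ‖restrict U v‖)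
    {D D' : Fin n → X} (hD : Neighboring D D') (θ : Model d) :
    ‖restrict U (gradient (empiricalRisk loss D) θ - gradient (empiricalRisk loss D') θ)‖ ≤
      2 * L / n := by
  have hb : ∀ ζ, ‖restrict U (gradient (fun w => loss w ζ) θ)‖ ≤ L := fun ζ =>
    norm_restrict_gradient_le hL (h_diff ζ).differentiableAt fun v => hlip ζ v θ
  rw [gradient_empiricalRisk h_diff, gradient_empiricalRisk h_diff, ← smul_sub,
    ← Finset.sum_sub_distrib, restrict_smul, norm_smul, Real.norm_of_nonneg (by positivity),
    one_div_mul_eq_div]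
  gcongr
  by_cases hex : ∃ i, D i ≠ D' i
  · obtain ⟨i, hi⟩ := hex
    have hone : ∀ j ≠ i, D j = D' j := by
      intro j hj
      by_contra hne
      exact hj ((Set.ncard_le_one (Set.toFinite _)).1 hD j hne i hi)
    rw [Finset.sum_eq_single i (fun j _ hj => by rw [hone j hj, sub_self]) (by simp), restrict_sub]
    exact (norm_sub_le _ _).trans (by linarith [hb (D i), hb (D' i)])
  · push Not at hex
    have h0 : restrict U (0 : Model d) = 0 := by simpa using restrict_smul U 0 (0 : Model d)
    simp only [hex, sub_self, Finset.sum_const_zero, h0, norm_zero]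
    positivity

/-! ### Composition along the algorithm -/

/-- The sketch annihilates the coordinates outside S, so only the restricted difference of the
gradients has to be hidden by the noise. -/
lemma update_eq_update_add {d : ℕ} (I : Input d) (f f' : Model d → ℝ) (S : Finset (Fin d))
    (θ η : Model d) :
    update I f S θ η = update I f' S θ (η + restrict S (gradient f θ - gradient f' θ)) := by
  ext j
  simp only [update, diagMul, sketchDiag, PiLp.sub_apply, PiLp.add_apply, restrict_apply]
  split <;> ring

section Composition

variable {d : ℕ} {I : Input d} {f f' : Model d → ℝ} {α β : ℝ}

lemma holderDominated_stepLaw (hα : α.HolderConjugate β) {r : ℝ}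
    (hσ : ∀ S ∈ I.𝒮.support, I.σ S ≠ 0) (θ : Model d)
    (hs : ∀ S ∈ I.𝒮.support,
      ‖restrict S (gradient f θ - gradient f' θ)‖ ^ 2 / (2 * I.σ S ^ 2) ≤ r) :
    HolderDominated β (ENNReal.ofReal (Real.exp ((α - 1) * r))) (stepLaw I f θ)
      (stepLaw I f' θ) := by
  refine HolderDominated.sum_smul hα.symm.lt.le ?_ fun S hS => ?_
  · rw [← tsum_fintype (L := SummationFilter.unconditional _), I.𝒮.tsum_coe]
  have hm : Measurable (update I f' S θ) :=
    (measurable_update I f' S).comp (measurable_prodMk_left (x := θ))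
  have hu : update I f S θ =
      update I f' S θ ∘ (· + restrict S (gradient f θ - gradient f' θ)) :=
    funext (update_eq_update_add I f f' S θ)
  rw [hu, ← Measure.map_map hm (by fun_prop)]
  refine ((holderDominated_add_multivariateGaussian hα (hσ S hS) _).map hm).mono ?_
  have := hα.sub_one_pos
  gcongr
  exact hs S hS

variable {c : ℝ≥0∞}

lemma holderDominated_innerLaw (hβ : 0 < β)
    (h : ∀ θ, HolderDominated β c (stepLaw I f θ) (stepLaw I f' θ)) (w : Model d) (k : ℕ) :
    HolderDominated β (c ^ k) (innerLaw I f w k) (innerLaw I f' w k) := by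
  induction k with
  | zero => rw [pow_zero]; exact HolderDominated.dirac hβ _
  | succ k ih =>
    rw [pow_succ']
    exact ih.bind hβ (measurable_innerStep I f) (measurable_innerStep I f')
      fun s => (h s.1).map (by fun_prop)

lemma holderDominated_outerLaw (hβ : 0 < β)
    (h : ∀ θ, HolderDominated β c (stepLaw I f θ) (stepLaw I f' θ)) (t : ℕ) :
    HolderDominated β ((c ^ I.K) ^ t) (outerLaw I f t) (outerLaw I f' t) := by
  induction t with
  | zero => rw [pow_zero]; exact HolderDominated.dirac hβ _
  | succ t ih =>
    rw [pow_succ']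
    exact ih.bind hβ (measurable_outerStep I f) (measurable_outerStep I f')
      fun w => (holderDominated_innerLaw hβ h w I.K).map (by fun_prop)

end Composition

end DPSkGD

/-! ### Choice of the order α and conclusion -/

theorem mainTheorem1 {d n : ℕ} {X : Type*} (hn : 0 < n)
    (I : DPSkGD.Input d) (hK : 0 < I.K)
    (h𝒮_nonvacuous : DPSkGD.Nonvacuous I.𝒮) (h𝒮_proper : DPSkGD.Proper I.𝒮)
    (loss : DPSkGD.Model d → X → ℝ)
    (h_diff : ∀ ζ, Differentiable ℝ fun w => loss w ζ)
    (h_conv : ∀ ζ, ConvexOn ℝ Set.univ fun w => loss w ζ)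
    (L : Finset (Fin d) → ℝ) (h_lip : DPSkGD.ComponentLipschitz I.𝒮 L loss)
    (ε δ : ℝ) (hε : 0 < ε) (hε1 : ε ≤ 1) (hδ : 0 < δ) (hδ3 : δ < 1 / 3)
    (hσ : ∀ U ∈ I.𝒮.support,
      I.σ U ^ 2 = 12 * L U ^ 2 * I.K * I.T * Real.log (1 / δ) / (n ^ 2 * ε ^ 2)) :
    DPSkGD.IsDifferentiallyPrivate (n := n) (X := X) (DPSkGD.dpSkGD I loss) ε δ := by
  intro D D' hD A hA
  set l := Real.log (1 / δ) with hl
  -- This is where δ < 1/3 enters: 1 / δ > 3 > e.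
  have hl1 : 1 ≤ l := by
    rw [hl, Real.le_log_iff_exp_le (by positivity)]
    have h3 : (3 : ℝ) ≤ 1 / δ := by rw [le_div_iff₀ hδ]; linarith
    linarith [Real.exp_one_lt_d9]
  have hδl : Real.exp (-l) = δ := by
    rw [hl, one_div, Real.log_inv, neg_neg, Real.exp_log hδ]
  -- With α - 1 = x l / ε, the final exponent is x ε / 6 + x² l / 6 - x l. As ε ≤ 1 ≤ l, it is at
  -- most -l once x² - 5 x + 6 ≤ 0, that is, 2 ≤ x ≤ 3; the midpoint x = 5/2 is taken.
  let α : ℝ := 1 + 5 * l / (2 * ε)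
  have hα1 : 1 < α := by
    have : 0 < 5 * l / (2 * ε) := by positivity
    simp only [α]
    linarith
  have hα : α.HolderConjugate α.conjExponent := Real.HolderConjugate.conjExponent hα1
  -- The total over the K T steps, (α - 1) ε² / (6 l).
  obtain ⟨r, hr⟩ : ∃ r : ℝ, r = 5 * ε / 12 := ⟨_, rfl⟩
  have hdom : DPSkGD.HolderDominated α.conjExponent (ENNReal.ofReal (Real.exp r))
      (DPSkGD.outerLaw I (DPSkGD.empiricalRisk loss D) I.T)
      (DPSkGD.outerLaw I (DPSkGD.empiricalRisk loss D') I.T) := by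
    -- For T = 0 the noise scales vanish and the Gaussian bound is unavailable, but both outputs are
    -- the initial point.
    rcases Nat.eq_zero_or_pos I.T with hT | hT
    · rw [hT]
      refine (DPSkGD.HolderDominated.dirac hα.symm.pos I.w₀).mono ?_
      rw [ENNReal.one_le_ofReal, Real.one_le_exp_iff, hr]
      positivity
    have hn' : (0 : ℝ) < n := Nat.cast_pos.2 hn
    have hK' : (0 : ℝ) < I.K := Nat.cast_pos.2 hK
    have hT' : (0 : ℝ) < I.T := Nat.cast_pos.2 hT
    have hl0 : 0 < l := by linarith
    have hσ0 : ∀ U ∈ I.𝒮.support, 0 < I.σ U ^ 2 := by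
      intro U hU
      have hL := (h_lip U hU).1
      rw [hσ U hU]
      positivity
    have hstep : ∀ θ, DPSkGD.HolderDominated α.conjExponent
        (ENNReal.ofReal (Real.exp ((α - 1) * (ε ^ 2 / (6 * I.K * I.T * l)))))
        (DPSkGD.stepLaw I (DPSkGD.empiricalRisk loss D) θ)
        (DPSkGD.stepLaw I (DPSkGD.empiricalRisk loss D') θ) := by
      intro θ
      refine DPSkGD.holderDominated_stepLaw hα
        (fun U hU h0 => by simpa [h0] using hσ0 U hU) θ fun U hU => ?_
      obtain ⟨hL, hlip⟩ := h_lip U hU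
      rw [div_le_iff₀ (mul_pos two_pos (hσ0 U hU)), hσ U hU]
      calc _ ≤ (2 * L U / n) ^ 2 := by
            gcongr
            exact DPSkGD.norm_restrict_gradient_empiricalRisk_sub_le hL.le h_diff hlip hD θ
        _ = _ := by field_simp; norm_num
    have h := DPSkGD.holderDominated_outerLaw hα.symm.pos hstep I.T
    rw [← pow_mul, ← ENNReal.ofReal_pow (Real.exp_nonneg _), ← Real.exp_nat_mul] at h
    convert h using 3
    simp only [α, hr]
    push_cast
    field_simp
    rw [add_sub_cancel_left]
    ring
  refine hdom.apply_le_exp_mul_add hα hδ.le ?_ hA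
  rw [← hδl, Real.exp_le_exp, hr]
  have h1 : (α - 1) * ε = 5 * l / 2 := by
    simp only [α]
    field_simp
    ring
  have h2 : α * (5 * ε / 12) = 5 * ε / 12 + 5 / 12 * ((α - 1) * ε) := by ring
  rw [h2, h1]
  linarith
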